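/- Let $D=(V,A)$ be a finite digraph (parallel edges and loops allowed), let $m:V\to\mathbf Z$ satisfy $\sum_{v\in V}m(v)=0$, and write $\widetilde m(Z)=\sum_{v\in Z}m(v)$ for $Z\subseteq V$. Let $f:A\to\mathbf Z\cup\{-\infty\}$ and $g:A\to\mathbf Z\cup\{+\infty\}$ satisfy $f\le g$. For a function $w$ on $A$ and $Z\subseteq V$, let $\varrho_w(Z)$ and $\delta_w(Z)$ be the sums of $w(e)$ over the edges $e$ entering $Z$ and leaving $Z$, respectively. An $m$-flow is a function $x:A\to\mathbf R$ with $\varrho_x(\{v\})-\delta_x(\{v\})=m(v)$ for every $v\in V$; it is $(f,g)$-bounded if $f\le x\le g$. Assume that there exists an $(f,g)$-bounded $m$-flow. Let $L\subseteq A$ be such that $-\infty<f(e)<g(e)<+\infty$ for every $e\in L$; an edge $e\in L$ is $g$-saturated by $x$ if $x(e)=g(e)$. Then there is an integer-valued $(f,g)$-bounded $m$-flow, and the minimum number of $g$-saturated edges of $L$ in such an $m$-flow is equal to $$\max\Big\{\varrho_L(\mathcal C)-\sum_{Z\in\mathcal C}\big[\varrho_g(Z)-\delta_f(Z)-\widetilde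 m(Z)\big]\Big\},$$ where the maximum (which is attained) is taken over all chains $\mathcal C$ (possibly empty, ordered by inclusion) of subsets $Z$ of $V$ with $\varrho_g(Z)-\delta_f(Z)<+\infty$, and $\varrho_L(\mathcal C)$ denotes the number of edges of $L$ entering at least one member of $\mathcal C$. In particular, if the minimum is zero, then the maximum is attained at the empty chain. -/

import Mathlib

/-- A directed multigraph with node set `V` and edge set `A` (loops and parallel edges allowed). -/
structure MultiDigraph (V A : Type*) where
  tail : A → V
  head : A → V

namespace MultiDigraph

variable {V A : Type*} (D : MultiDigraph V A)

/-- The edge `e` enters the node set `Z`. -/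
def Enters (e : A) (Z : Finset V) : Prop := D.head e ∈ Z ∧ D.tail e ∉ Z

/-- The edge `e` leaves the node set `Z`. -/
def Leaves (e : A) (Z : Finset V) : Prop := D.tail e ∈ Z ∧ D.head e ∉ Z

instance [DecidableEq V] (e : A) (Z : Finset V) : Decidable (D.Enters e Z) :=
  inferInstanceAs (Decidable (_ ∧ _))

instance [DecidableEq V] (e : A) (Z : Finset V) : Decidable (D.Leaves e Z) :=
  inferInstanceAs (Decidable (_ ∧ _))

/-- `ϱ_w(Z)`: the total `w`-value of the edges entering `Z`. -/
def inSum [Fintype A] [DecidableEq V] {M : Type*} [AddCommMonoid M]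
    (w : A → M) (Z : Finset V) : M :=
  ∑ e with D.Enters e Z, w e

/-- `δ_w(Z)`: the total `w`-value of the edges leaving `Z`. -/
def outSum [Fintype A] [DecidableEq V] {M : Type*} [AddCommMonoid M]
    (w : A → M) (Z : Finset V) : M :=
  ∑ e with D.Leaves e Z, w e

/-- `ϱ_L(C)`: the number of edges of `L` entering at least one member of `C`. -/
def enteringCount [DecidableEq V] (L : Finset A) (C : Finset (Finset V)) : ℕ :=
  (L.filter fun e => ∃ Z ∈ C, D.Enters e Z).card

end MultiDigraph

/-- A lower bound, in `ℤ ∪ {-∞}`, as an extended real number. -/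
noncomputable def lowerToEReal : WithBot ℤ → EReal :=
  WithBot.recBotCoe ⊥ (fun z : ℤ => ((z : ℝ) : EReal))

/-- An upper bound, in `ℤ ∪ {+∞}`, as an extended real number. -/
noncomputable def upperToEReal : WithTop ℤ → EReal :=
  WithTop.recTopCoe ⊤ (fun z : ℤ => ((z : ℝ) : EReal))

namespace MultiDigraph

variable {V A : Type*} [Fintype A] [DecidableEq V] (D : MultiDigraph V A)

/-- `x` is an `m`-flow: `ϱ_x(v) - δ_x(v) = m(v)` at every node `v`. -/
def IsModFlow (m : V → ℤ) (x : A → ℝ) : Prop :=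
  ∀ v, D.inSum x {v} - D.outSum x {v} = (m v : ℝ)

/-- `x` is an `(f,g)`-bounded (feasible) `m`-flow. -/
def IsFeasibleModFlow (f : A → WithBot ℤ) (g : A → WithTop ℤ) (m : V → ℤ) (x : A → ℝ) : Prop :=
  D.IsModFlow m x ∧ ∀ e, lowerToEReal (f e) ≤ (x e : EReal) ∧ (x e : EReal) ≤ upperToEReal (g e)

/-- `x` is an integer-valued `(f,g)`-bounded `m`-flow. -/
def IsIntFeasibleModFlow (f : A → WithBot ℤ) (g : A → WithTop ℤ) (m : V → ℤ)
    (x : A → ℤ) : Prop :=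
  D.IsFeasibleModFlow f g m fun e => (x e : ℝ)

/-- `ϱ_g(Z) - δ_f(Z)`. No term of `ϱ_g(Z)` is `-∞` and no term of `δ_f(Z)` is `+∞`, so that
no undefined sum or difference occurs. -/
noncomputable def cutBound (f : A → WithBot ℤ) (g : A → WithTop ℤ) (Z : Finset V) : EReal :=
  D.inSum (fun e => upperToEReal (g e)) Z - D.outSum (fun e => lowerToEReal (f e)) Z

/-- A chain of node sets `Z`, each with `ϱ_g(Z) - δ_f(Z) < +∞`. -/
def IsFiniteChain (f : A → WithBot ℤ) (g : A → WithTop ℤ) (C : Finset (Finset V)) : Prop :=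
  IsChain (· ⊆ ·) (C : Set (Finset V)) ∧ ∀ Z ∈ C, D.cutBound f g Z < ⊤

/-- `ϱ_L(C) - ∑_{Z ∈ C} (ϱ_g(Z) - δ_f(Z) - m̃(Z))`, where `m̃(Z) = ∑_{v ∈ Z} m(v)`. -/
noncomputable def chainValue (f : A → WithBot ℤ) (g : A → WithTop ℤ) (m : V → ℤ)
    (L : Finset A) (C : Finset (Finset V)) : EReal :=
  (D.enteringCount L C : EReal) -
    ∑ Z ∈ C, (D.cutBound f g Z - (((∑ v ∈ Z, m v : ℤ) : ℝ) : EReal))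

end MultiDigraph

/-- The number of edges `e ∈ L` that are `g`-saturated by `x`, that is, `x(e) = g(e)`. -/
def saturatedCount {A : Type*} (g : A → WithTop ℤ) (L : Finset A) (x : A → ℤ) : ℕ :=
  (L.filter fun e => ((x e : ℤ) : WithTop ℤ) = g e).card

/-!
The proof is linear programming duality for minimum cost flows, carried out combinatorially. Give an
edge of `L` cost one at its upper bound and cost zero below it; for the other edges the cost is
zero. For a potential `p : V → ℤ` call a value `y` of an edge `e` tight (`IsTight`) if it maximizes
`d * z - cost z` over the integers `z` within the bounds, where `d = p (head e) - p (tail e)` is the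
tension of `e`.

* Strong duality (`MultiDigraph.exists_flow_isTight`): among the potentials under which every edge
  has a tight value, take one of largest dual value `∑ p v * m v - ∑ (d * y - cost y)`; the given
  real flow bounds this value. A version of Hoffman's theorem (`MultiDigraph.exists_flow_or_cut`)
  gives an integral flow through tight values or a cut `Z` across which tight values cannot be
  moved by one. In the second case convexity of the cost (`IsTight.add_one`, `IsTight.sub_one`)
  keeps the values tight when the potential is raised by one on `Z`, and this raises the dual value.
  The existence of an integral flow is part of the conclusion, so that no rounding of the real flow
  is needed.
* From potentials to chains (`MultiDigraph.saturatedCount_le_chainValue`): by complementary slackness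
  the chain of upper level sets of the optimal potential has a value equal to the number of
  saturated edges of the flow. A jump of the potential by more than one repeats a level set, which
  a chain lists only once; this costs nothing, as the edges crossing such a set have tension at
  least two in absolute value, and tight values of these are at the bound that makes their slack
  zero.
* Weak duality (`MultiDigraph.chainValue_le_saturatedCount`): for a flow `x`, the bracket belonging
  to `Z` is the sum of `g - x` over the edges entering `Z` and of `x - f` over the edges leaving it,
  so each unsaturated edge of `L` that enters a member of the chain is paid for.
-/

/-! ### Net inflow, and flows through prescribed sets of integers -/

namespace MultiDigraph

/-- The net inflow `ϱ_x(v) - δ_x(v)` at the node `v`. -/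
def netIn {V A R : Type*} [Fintype A] [DecidableEq V] [AddCommGroup R]
    (D : MultiDigraph V A) (x : A → R) (v : V) : R :=
  D.inSum x {v} - D.outSum x {v}

section NetInflow

variable {V A : Type*} [Fintype A] [DecidableEq V] (D : MultiDigraph V A)

theorem inSum_sub_outSum {R : Type*} [CommRing R] (x : A → R) (Z : Finset V) :
    D.inSum x Z - D.outSum x Z =
      ∑ e, ((if D.head e ∈ Z then 1 else 0) - (if D.tail e ∈ Z then 1 else 0)) * x e := by
  simp only [inSum, outSum, Finset.sum_filter, ← Finset.sum_sub_distrib]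
  refine Finset.sum_congr rfl fun e _ => ?_
  by_cases h : D.head e ∈ Z <;> by_cases t : D.tail e ∈ Z <;> simp [Enters, Leaves, h, t]

theorem netIn_eq_sum {R : Type*} [CommRing R] (x : A → R) (v : V) :
    D.netIn x v =
      ∑ e, ((if D.head e = v then 1 else 0) - (if D.tail e = v then 1 else 0)) * x e := by
  simp [netIn, inSum_sub_outSum]

/-- Summation by parts: pairing a potential with the net inflow of `x` is pairing the tension of
the potential with `x`. -/
theorem sum_mul_netIn [Fintype V] {R : Type*} [CommRing R] (p : V → R) (x : A → R) :
    ∑ v, p v * D.netIn x v = ∑ e, (p (D.head e) - p (D.tail e)) * x e := by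
  simp only [netIn_eq_sum, Finset.mul_sum]
  rw [Finset.sum_comm]
  refine Finset.sum_congr rfl fun e _ => ?_
  simp only [← mul_assoc, ← Finset.sum_mul]
  congr 1
  simp [mul_sub, Finset.sum_sub_distrib]

theorem sum_netIn {R : Type*} [CommRing R] (x : A → R) (Z : Finset V) :
    ∑ v ∈ Z, D.netIn x v = D.inSum x Z - D.outSum x Z := by
  simp only [netIn_eq_sum, inSum_sub_outSum]
  rw [Finset.sum_comm]
  refine Finset.sum_congr rfl fun e _ => ?_
  rw [← Finset.sum_mul]
  simp [Finset.sum_sub_distrib]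

theorem netIn_update [DecidableEq A] (x : A → ℤ) (e : A) (c : ℤ) (v : V) :
    D.netIn (Function.update x e (x e + c)) v = D.netIn x v +
      ((if D.head e = v then 1 else 0) - (if D.tail e = v then 1 else 0)) * c := by
  have h : Function.update x e (x e + c) = fun a => x a + if a = e then c else 0 := by
    ext a
    by_cases ha : a = e
    · subst ha; simp
    · simp [ha]
  rw [h]
  simp only [netIn_eq_sum, mul_add, Finset.sum_add_distrib]
  simp

end NetInflow

section Feasibility

variable {V A : Type*} (D : MultiDigraph V A)

/-- The value at `e` of the integral vector `y` may be changed by one, within `I e`, so as to send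
one unit from `u` to `w`. -/
def Residual (I : A → Set ℤ) (y : A → ℤ) (u w : V) : Prop :=
  ∃ e, (D.tail e = u ∧ D.head e = w ∧ y e + 1 ∈ I e) ∨
    (D.head e = u ∧ D.tail e = w ∧ y e - 1 ∈ I e)

/-- The nodes from which `t` is reached by at most `n` residual steps. -/
def reachSet (I : A → Set ℤ) (y : A → ℤ) (t : V) : ℕ → Set V
  | 0 => {t}
  | n + 1 => {u | u ∈ reachSet I y t n ∨ ∃ w ∈ reachSet I y t n, D.Residual I y u w}

/-- One unit can be sent to `t` from any node that reaches it. The bound on the changed edges is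
what makes the induction work: an edge at a node that is reached first in step `n + 1` still has
its old value after the unit has been sent on in at most `n` steps. -/
theorem exists_push [Fintype A] [DecidableEq V] {I : A → Set ℤ} {y : A → ℤ} (hy : ∀ e, y e ∈ I e)
    (t : V) (n : ℕ) (s : V) (hs : s ∈ D.reachSet I y t n) :
    ∃ y' : A → ℤ, (∀ e, y' e ∈ I e) ∧
      (∀ e, y' e ≠ y e → D.tail e ∈ D.reachSet I y t n ∧ D.head e ∈ D.reachSet I y t n) ∧
      ∀ v, D.netIn y' v =
        D.netIn y v - (if s = v then 1 else 0) + (if t = v then 1 else 0) := by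
  classical
  induction n generalizing s with
  | zero =>
    obtain rfl : s = t := hs
    exact ⟨y, hy, fun e h => absurd rfl h, fun v => by ring⟩
  | succ n ih =>
    by_cases hsn : s ∈ D.reachSet I y t n
    · obtain ⟨y', h1, h2, h3⟩ := ih s hsn
      exact ⟨y', h1, fun e he => ⟨Or.inl (h2 e he).1, Or.inl (h2 e he).2⟩, h3⟩
    obtain ⟨w, hw, hr⟩ := hs.resolve_left hsn
    obtain ⟨y', h1, h2, h3⟩ := ih w hw
    have key : ∀ (e : A) (c : ℤ), y e + c ∈ I e → y' e = y e →
        (D.tail e ∈ D.reachSet I y t (n + 1) ∧ D.head e ∈ D.reachSet I y t (n + 1)) →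
        (∀ v, ((if D.head e = v then 1 else 0) - (if D.tail e = v then 1 else 0)) * c =
          (if w = v then 1 else 0) - (if s = v then (1 : ℤ) else 0)) →
        ∃ y' : A → ℤ, (∀ e, y' e ∈ I e) ∧
          (∀ e, y' e ≠ y e →
            D.tail e ∈ D.reachSet I y t (n + 1) ∧ D.head e ∈ D.reachSet I y t (n + 1)) ∧
          ∀ v, D.netIn y' v =
            D.netIn y v - (if s = v then 1 else 0) + (if t = v then 1 else 0) := by
      intro e c hc hye hends hv
      refine ⟨Function.update y' e (y' e + c), fun a => ?_, fun a ha => ?_, fun v => ?_⟩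
      · by_cases hae : a = e
        · subst hae; simpa [hye] using hc
        · simpa [hae] using h1 a
      · by_cases hae : a = e
        · subst hae; exact hends
        · rw [Function.update_of_ne hae] at ha
          exact ⟨Or.inl (h2 a ha).1, Or.inl (h2 a ha).2⟩
      · rw [netIn_update, h3, hv]; ring
    have hs' : s ∈ D.reachSet I y t (n + 1) := Or.inr ⟨w, hw, hr⟩
    have hw' : w ∈ D.reachSet I y t (n + 1) := Or.inl hw
    obtain ⟨e, ⟨rfl, rfl, he⟩ | ⟨rfl, rfl, he⟩⟩ := hr
    · refine key e 1 he ?_ ⟨hs', hw'⟩ fun v => by ring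
      by_contra hne
      exact hsn (h2 e hne).1
    · refine key e (-1) he ?_ ⟨hw', hs'⟩ fun v => by ring
      by_contra hne
      exact hsn (h2 e hne).2

/-- Hoffman's feasibility theorem for arbitrary nonempty sets `I e` of admissible integers: a vector
of admissible values that minimizes the total violation of the node equations is a flow, or else
the nodes from which a deficient node is reached form a cut that proves it stuck. -/
theorem exists_flow_or_cut [Fintype V] [Fintype A] [DecidableEq V] (m : V → ℤ)
    (hm : ∑ v, m v = 0) (I : A → Set ℤ) (hI : ∀ e, (I e).Nonempty) :
    ∃ y : A → ℤ, (∀ e, y e ∈ I e) ∧ ((∀ v, D.netIn y v = m v) ∨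
      ∃ Z : Finset V, (∀ e, D.Enters e Z → y e + 1 ∉ I e) ∧
        (∀ e, D.Leaves e Z → y e - 1 ∉ I e) ∧ D.inSum y Z - D.outSum y Z < ∑ v ∈ Z, m v) := by
  classical
  choose y₀ hy₀ using hI
  let F : (A → ℤ) → ℕ := fun y => ∑ v, (D.netIn y v - m v).natAbs
  obtain ⟨y, hy, hmin⟩ : ∃ y : A → ℤ, (∀ e, y e ∈ I e) ∧
      ∀ y' : A → ℤ, (∀ e, y' e ∈ I e) → F y ≤ F y' := by
    have hne : {y : A → ℤ | ∀ e, y e ∈ I e}.Nonempty := ⟨y₀, hy₀⟩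
    exact ⟨Function.argminOn F _ hne, Function.argminOn_mem F _ hne,
      fun y' hy' => Function.argminOn_le F {y : A → ℤ | ∀ e, y e ∈ I e} (a := y') hy'⟩
  refine ⟨y, hy, ?_⟩
  by_cases hflow : ∀ v, D.netIn y v = m v
  · exact Or.inl hflow
  right
  have hsum : ∑ v, (D.netIn y v - m v) = 0 := by
    rw [Finset.sum_sub_distrib, hm, sum_netIn, inSum_sub_outSum]
    simp
  obtain ⟨t, ht⟩ : ∃ t, D.netIn y t < m t := by
    by_contra! hcon
    refine hflow fun v => ?_
    have := (Finset.sum_eq_zero_iff_of_nonneg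
      (fun v _ => sub_nonneg.2 (hcon v))).1 hsum v (Finset.mem_univ v)
    linarith
  let Z : Finset V := {v | ∃ n, v ∈ D.reachSet I y t n}
  have hZ : ∀ u w, w ∈ Z → D.Residual I y u w → u ∈ Z := by
    intro u w hw hr
    obtain ⟨n, hn⟩ := (Finset.mem_filter.1 hw).2
    exact Finset.mem_filter.2 ⟨Finset.mem_univ _, n + 1, Or.inr ⟨w, hn, hr⟩⟩
  have htZ : t ∈ Z := Finset.mem_filter.2 ⟨Finset.mem_univ _, 0, rfl⟩
  refine ⟨Z, fun e he hI => ?_, fun e he hI => ?_, ?_⟩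
  · exact he.2 (hZ _ _ he.1 ⟨e, Or.inl ⟨rfl, rfl, hI⟩⟩)
  · exact he.2 (hZ _ _ he.1 ⟨e, Or.inr ⟨rfl, rfl, hI⟩⟩)
  rw [← sum_netIn]
  refine Finset.sum_lt_sum (fun s hs => ?_) ⟨t, htZ, ht⟩
  by_contra! hcon
  obtain ⟨n, hn⟩ := (Finset.mem_filter.1 hs).2
  obtain ⟨y', h1, -, h3⟩ := D.exists_push hy t n s hn
  -- A unit sent from the surplus node `s` to the deficient node `t` lowers the violation.
  refine absurd (hmin y' h1) (not_le.2 ?_)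
  refine Finset.sum_lt_sum (fun v _ => ?_) ⟨t, Finset.mem_univ _, ?_⟩
  · rw [h3]
    split_ifs <;> subst_vars <;> omega
  · rw [h3]
    have hst : s ≠ t := by rintro rfl; omega
    simp only [hst, if_true, if_false]
    omega

end Feasibility

end MultiDigraph

/-! ### Tight values of a single edge -/

section Tightness

/-- The integers between a lower bound in `ℤ ∪ {-∞}` and an upper bound in `ℤ ∪ {+∞}`. -/
def boundedInts (a : WithBot ℤ) (b : WithTop ℤ) : Set ℤ :=
  {z | a ≤ (z : WithBot ℤ) ∧ (z : WithTop ℤ) ≤ b}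

open Classical in
/-- The cost of the value `z` on an edge with upper bound `b`: one if the edge is counted, as told
by `l`, and `z` saturates it, and zero otherwise. -/
noncomputable def satCost (l : Prop) (b : WithTop ℤ) (z : ℤ) : ℤ :=
  if l ∧ (z : WithTop ℤ) = b then 1 else 0

/-- Complementary slackness between a value `y` and a tension `d` of an edge: among the values
within the bounds, `y` maximizes `d * z` minus the cost of `z`. -/
def IsTight (a : WithBot ℤ) (b : WithTop ℤ) (l : Prop) (d y : ℤ) : Prop :=
  y ∈ boundedInts a b ∧ ∀ z ∈ boundedInts a b, d * z - satCost l b z ≤ d * y - satCost l b y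

variable {a : WithBot ℤ} {b : WithTop ℤ} {l : Prop} {d y z : ℤ}

theorem satCost_nonneg : 0 ≤ satCost l b z := by
  unfold satCost; split_ifs <;> simp

theorem satCost_le_one : satCost l b z ≤ 1 := by
  unfold satCost; split_ifs <;> simp

theorem satCost_eq_zero_of_lt (hz : (z : WithTop ℤ) < b) : satCost l b z = 0 := by
  simp [satCost, hz.ne]

theorem satCost_eq_zero_of_not (h : ¬ l) : satCost l b z = 0 := by
  simp [satCost, h]

theorem satCost_mono (hzb : (z : WithTop ℤ) ≤ b) (hyz : y ≤ z) :
    satCost l b y ≤ satCost l b z := by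
  rcases hyz.eq_or_lt with rfl | h
  · rfl
  · rw [satCost_eq_zero_of_lt ((WithTop.coe_lt_coe.2 h).trans_le hzb)]
    exact satCost_nonneg

theorem mem_boundedInts_of_le_of_le {x : ℤ} (hx : x ∈ boundedInts a b) (hz : z ∈ boundedInts a b)
    (hxy : x ≤ y) (hyz : y ≤ z) : y ∈ boundedInts a b :=
  ⟨hx.1.trans (WithBot.coe_le_coe.2 hxy), (WithTop.coe_le_coe.2 hyz).trans hz.2⟩

/-- Since the cost is convex, a value that is tight while its successor is not remains tight when
the tension grows by one. -/
theorem IsTight.add_one (h : IsTight a b l d y) (h' : ¬ IsTight a b l d (y + 1)) :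
    IsTight a b l (d + 1) y := by
  refine ⟨h.1, fun z hz => ?_⟩
  have hzy := h.2 z hz
  rcases le_or_gt z y with hle | hlt
  · linarith
  have hmem : y + 1 ∈ boundedInts a b := mem_boundedInts_of_le_of_le h.1 hz (by omega) hlt
  -- The step from `y` to `y + 1` costs more than `d`, hence at least `d + 1`.
  have hstep : d + 1 ≤ satCost l b (y + 1) - satCost l b y := by
    by_contra! hcon
    refine h' ⟨hmem, fun w hw => ?_⟩
    have := h.2 w hw
    linarith
  have hy0 : satCost l b y = 0 := satCost_eq_zero_of_lt
    ((WithTop.coe_lt_coe.2 hlt).trans_le hz.2)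
  have hmono : satCost l b (y + 1) ≤ satCost l b z := satCost_mono hz.2 hlt
  rcases (show y + 1 ≤ z from hlt).eq_or_lt with rfl | hlt'
  · linarith
  · have : satCost l b (y + 1) = 0 := satCost_eq_zero_of_lt
      ((WithTop.coe_lt_coe.2 hlt').trans_le hz.2)
    nlinarith

theorem IsTight.sub_one (h : IsTight a b l d y) (h' : ¬ IsTight a b l d (y - 1)) :
    IsTight a b l (d - 1) y := by
  refine ⟨h.1, fun z hz => ?_⟩
  have hzy := h.2 z hz
  rcases le_or_gt y z with hle | hlt
  · linarith
  have hmem : y - 1 ∈ boundedInts a b := mem_boundedInts_of_le_of_le hz h.1 (by omega) (by omega)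
  have hstep : 1 - d ≤ satCost l b (y - 1) - satCost l b y := by
    by_contra! hcon
    refine h' ⟨hmem, fun w hw => ?_⟩
    have := h.2 w hw
    linarith
  have h0 : satCost l b (y - 1) = 0 := satCost_eq_zero_of_lt
    ((WithTop.coe_lt_coe.2 (by omega)).trans_le h.1.2)
  have h0' : satCost l b z = 0 := satCost_eq_zero_of_lt
    ((WithTop.coe_lt_coe.2 hlt).trans_le h.1.2)
  have hy1 : 0 ≤ satCost l b y := satCost_nonneg
  nlinarith

/-- A tight value on an edge of positive tension falls short of the upper bound by at most one, and
only if the edge is counted and its tension is one. -/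
theorem IsTight.of_pos (h : IsTight a b l d y) (hd : 0 < d) (hb : l → b < ⊤) :
    (y : WithTop ℤ) = b ∨ l ∧ d = 1 ∧ ((y + 1 : ℤ) : WithTop ℤ) = b := by
  by_contra! hcon
  have hlt : (y : WithTop ℤ) < b := lt_of_le_of_ne h.1.2 hcon.1
  have hle : ((y + 1 : ℤ) : WithTop ℤ) ≤ b := by
    cases b with
    | top => exact le_top
    | coe b => exact WithTop.coe_le_coe.2 (WithTop.coe_lt_coe.1 hlt)
  have hmem : y + 1 ∈ boundedInts a b :=
    ⟨h.1.1.trans (WithBot.coe_le_coe.2 (by omega)), hle⟩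
  have h1 := h.2 _ hmem
  rw [satCost_eq_zero_of_lt hlt] at h1
  have h2 : satCost l b (y + 1) ≤ 1 := satCost_le_one
  by_cases hl : l
  · have hd1 : d = 1 := by linarith
    have h3 : satCost l b (y + 1) = 0 :=
      satCost_eq_zero_of_lt (lt_of_le_of_ne hle (hcon.2 hl hd1))
    linarith
  · rw [satCost_eq_zero_of_not hl] at h1
    linarith

theorem IsTight.of_neg (h : IsTight a b l d y) (hd : d < 0) : a = (y : WithBot ℤ) := by
  by_contra hne
  have hlt : a < (y : WithBot ℤ) := lt_of_le_of_ne h.1.1 hne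
  have hle : a ≤ ((y - 1 : ℤ) : WithBot ℤ) := by
    cases a with
    | bot => exact bot_le
    | coe a => exact WithBot.coe_le_coe.2 (by have := WithBot.coe_lt_coe.1 hlt; omega)
  have h1 := h.2 (y - 1) ⟨hle, (WithTop.coe_le_coe.2 (by omega)).trans h.1.2⟩
  have h2 : satCost l b (y - 1) ≤ satCost l b y := satCost_mono h.1.2 (by omega)
  linarith

/-- A counted edge that is saturated by a tight value has positive tension. -/
theorem IsTight.pos_of_saturated (h : IsTight a b l d y) (hl : l) (hy : (y : WithTop ℤ) = b)
    (hab : a < (y : WithBot ℤ)) : 0 < d := by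
  have hle : a ≤ ((y - 1 : ℤ) : WithBot ℤ) := by
    cases a with
    | bot => exact bot_le
    | coe a => exact WithBot.coe_le_coe.2 (by have := WithBot.coe_lt_coe.1 hab; omega)
  have h1 := h.2 (y - 1) ⟨hle, (WithTop.coe_le_coe.2 (by omega)).trans h.1.2⟩
  have h2 : satCost l b (y - 1) = 0 := satCost_eq_zero_of_lt
    (hy ▸ WithTop.coe_lt_coe.2 (by omega))
  have h3 : satCost l b y = 1 := by simp [satCost, hl, hy]
  linarith

theorem lowerToEReal_coe (z : ℤ) : lowerToEReal (z : WithBot ℤ) = ((z : ℝ) : EReal) := rfl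

theorem lowerToEReal_bot : lowerToEReal ⊥ = ⊥ := rfl

theorem upperToEReal_coe (z : ℤ) : upperToEReal (z : WithTop ℤ) = ((z : ℝ) : EReal) := rfl

theorem upperToEReal_top : upperToEReal ⊤ = ⊤ := rfl

theorem le_floor_of_lowerToEReal_le {x : ℝ} (h : lowerToEReal a ≤ (x : EReal)) :
    a ≤ (⌊x⌋ : WithBot ℤ) := by
  cases a with
  | bot => exact bot_le
  | coe a =>
    rw [lowerToEReal_coe, EReal.coe_le_coe_iff] at h
    exact WithBot.coe_le_coe.2 (Int.le_floor.2 h)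

theorem ceil_le_of_le_upperToEReal {x : ℝ} (h : (x : EReal) ≤ upperToEReal b) :
    (⌈x⌉ : WithTop ℤ) ≤ b := by
  cases b with
  | top => exact le_top
  | coe b =>
    rw [upperToEReal_coe, EReal.coe_le_coe_iff] at h
    exact WithTop.coe_le_coe.2 (Int.ceil_le.2 h)

theorem mem_boundedInts_iff :
    z ∈ boundedInts a b ↔
      lowerToEReal a ≤ ((z : ℝ) : EReal) ∧ ((z : ℝ) : EReal) ≤ upperToEReal b := by
  refine ⟨fun h => ⟨?_, ?_⟩, fun h => ⟨?_, ?_⟩⟩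
  · cases a with
    | bot => exact bot_le
    | coe a => simpa [lowerToEReal_coe] using h.1
  · cases b with
    | top => exact le_top
    | coe b => simpa [upperToEReal_coe] using h.2
  · simpa using le_floor_of_lowerToEReal_le h.1
  · simpa using ceil_le_of_le_upperToEReal h.2

/-- Tightness bounds the real values as well: a linear function on an interval with integral ends
is at most its larger value at the two integers next to the point. -/
theorem IsTight.real_le (h : IsTight a b l d y) {x : ℝ} (hx1 : lowerToEReal a ≤ (x : EReal))
    (hx2 : (x : EReal) ≤ upperToEReal b) : d * x ≤ d * y - satCost l b y + 1 := by
  have h1 := le_floor_of_lowerToEReal_le hx1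
  have h2 := ceil_le_of_le_upperToEReal hx2
  have hfc : ⌊x⌋ ≤ ⌈x⌉ := Int.floor_le_ceil x
  have key : ∀ z ∈ boundedInts a b, (d * z : ℝ) ≤ d * y - satCost l b y + 1 := by
    intro z hz
    have h3 := h.2 z hz
    have h4 : satCost l b z ≤ 1 := satCost_le_one
    have : d * z ≤ d * y - satCost l b y + 1 := by linarith
    exact_mod_cast this
  rcases le_total 0 d with hd | hd
  · refine le_trans ?_ (key ⌈x⌉ ⟨h1.trans (WithBot.coe_le_coe.2 hfc), h2⟩)
    exact mul_le_mul_of_nonneg_left (Int.le_ceil x) (by exact_mod_cast hd)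
  · refine le_trans ?_ (key ⌊x⌋ ⟨h1, (WithTop.coe_le_coe.2 hfc).trans h2⟩)
    exact mul_le_mul_of_nonpos_left (Int.floor_le x) (by exact_mod_cast hd)

/-- At tension zero, the tight values are those of cost zero. -/
theorem exists_isTight_zero (hne : (boundedInts a b).Nonempty)
    (hl : l → ⊥ < a ∧ lowerToEReal a < upperToEReal b ∧ b < ⊤) :
    ∃ y, IsTight a b l 0 y := by
  obtain ⟨y, hy, h0⟩ : ∃ y ∈ boundedInts a b, satCost l b y = 0 := by
    by_cases h : l
    · obtain ⟨h1, h2, h3⟩ := hl h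
      lift a to ℤ using h1.ne'
      lift b to ℤ using h3.ne
      rw [lowerToEReal_coe, upperToEReal_coe, EReal.coe_lt_coe_iff, Int.cast_lt] at h2
      exact ⟨a, ⟨le_rfl, WithTop.coe_le_coe.2 h2.le⟩,
        satCost_eq_zero_of_lt (WithTop.coe_lt_coe.2 h2)⟩
    · obtain ⟨y, hy⟩ := hne
      exact ⟨y, hy, satCost_eq_zero_of_not h⟩
  refine ⟨y, hy, fun z _ => ?_⟩
  have : 0 ≤ satCost l b z := satCost_nonneg
  linarith

end Tightness

/-! ### Strong duality -/

namespace MultiDigraph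

variable {V A : Type*} [Fintype A] [DecidableEq V] (D : MultiDigraph V A)

theorem isIntFeasibleModFlow_iff {f : A → WithBot ℤ} {g : A → WithTop ℤ} {m : V → ℤ} {x : A → ℤ} :
    D.IsIntFeasibleModFlow f g m x ↔
      (∀ v, D.netIn x v = m v) ∧ ∀ e, x e ∈ boundedInts (f e) (g e) := by
  simp only [IsIntFeasibleModFlow, IsFeasibleModFlow, IsModFlow, mem_boundedInts_iff]
  refine and_congr_left fun _ => forall_congr' fun v => ?_
  simp only [netIn, inSum, outSum]
  exact_mod_cast Iff.rfl

/-- The objective value of a potential in the linear programming dual, written with the tight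
values `y` of its tensions. -/
noncomputable def dualValue [Fintype V] (m : V → ℤ) (g : A → WithTop ℤ) (L : Finset A)
    (p : V → ℤ) (y : A → ℤ) : ℤ :=
  ∑ v, p v * m v -
    ∑ e, ((p (D.head e) - p (D.tail e)) * y e - satCost (e ∈ L) (g e) (y e))

theorem dualValue_le_card [Fintype V] {m : V → ℤ} {f : A → WithBot ℤ} {g : A → WithTop ℤ}
    {L : Finset A} (hQ : ∃ x : A → ℝ, D.IsFeasibleModFlow f g m x) {p : V → ℤ} {y : A → ℤ}
    (h : ∀ e, IsTight (f e) (g e) (e ∈ L) (p (D.head e) - p (D.tail e)) (y e)) :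
    D.dualValue m g L p y ≤ Fintype.card A := by
  obtain ⟨x, hx, hb⟩ := hQ
  have h1 : ∑ v, (p v : ℝ) * m v = ∑ e, ((p (D.head e) : ℝ) - p (D.tail e)) * x e := by
    rw [← sum_mul_netIn D (fun v => (p v : ℝ)) x]
    exact Finset.sum_congr rfl fun v _ => by rw [netIn, hx v]
  have h2 : ∀ e, ((p (D.head e) : ℝ) - p (D.tail e)) * x e ≤
      (((p (D.head e) : ℝ) - p (D.tail e)) * y e - satCost (e ∈ L) (g e) (y e)) + 1 := by
    intro e
    simpa using (h e).real_le (hb e).1 (hb e).2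
  have h3 := Finset.sum_le_sum fun e (_ : e ∈ Finset.univ) => h2 e
  rw [Finset.sum_add_distrib, ← h1] at h3
  simp only [Finset.sum_const, Finset.card_univ, nsmul_eq_mul, mul_one] at h3
  have : (D.dualValue m g L p y : ℝ) ≤ Fintype.card A := by
    rw [dualValue]
    push_cast
    linarith
  exact_mod_cast this

/-- Strong duality: there are an integral flow and an integral potential that satisfy complementary
slackness on every edge. For a potential of largest dual value, a cut without a flow through tight
values would be a direction of ascent. -/
theorem exists_flow_isTight [Fintype V] {m : V → ℤ} (hm : ∑ v, m v = 0)
    {f : A → WithBot ℤ} {g : A → WithTop ℤ} {L : Finset A}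
    (hL : ∀ e ∈ L, ⊥ < f e ∧ lowerToEReal (f e) < upperToEReal (g e) ∧ g e < ⊤)
    (hQ : ∃ x : A → ℝ, D.IsFeasibleModFlow f g m x) :
    ∃ (p : V → ℤ) (y : A → ℤ), (∀ v, D.netIn y v = m v) ∧
      ∀ e, IsTight (f e) (g e) (e ∈ L) (p (D.head e) - p (D.tail e)) (y e) := by
  have hne : ∀ e, (boundedInts (f e) (g e)).Nonempty := fun e => by
    obtain ⟨x, -, hb⟩ := hQ
    exact ⟨⌊x e⌋, le_floor_of_lowerToEReal_le (hb e).1,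
      (WithTop.coe_le_coe.2 (Int.floor_le_ceil _)).trans (ceil_le_of_le_upperToEReal (hb e).2)⟩
  obtain ⟨p, y, hpy, hmax⟩ : ∃ (p : V → ℤ) (y : A → ℤ),
      (∀ e, IsTight (f e) (g e) (e ∈ L) (p (D.head e) - p (D.tail e)) (y e)) ∧
      ∀ (p' : V → ℤ) (y' : A → ℤ),
        (∀ e, IsTight (f e) (g e) (e ∈ L) (p' (D.head e) - p' (D.tail e)) (y' e)) →
        D.dualValue m g L p' y' ≤ D.dualValue m g L p y := by
    obtain ⟨k, ⟨p, y, hpy, rfl⟩, hk⟩ := Int.exists_greatest_of_bdd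
      (P := fun k => ∃ (p : V → ℤ) (y : A → ℤ),
        (∀ e, IsTight (f e) (g e) (e ∈ L) (p (D.head e) - p (D.tail e)) (y e)) ∧
          D.dualValue m g L p y = k)
      ⟨Fintype.card A, by rintro k ⟨p, y, h, rfl⟩; exact D.dualValue_le_card hQ h⟩
      (by
        choose y hy using fun e => exists_isTight_zero (hne e) (hL e)
        exact ⟨_, 0, y, by simpa using hy, rfl⟩)
    exact ⟨p, y, hpy, fun p' y' h => hk _ ⟨p', y', h, rfl⟩⟩
  obtain ⟨z, hz, hflow | ⟨Z, hent, hlea, hlt⟩⟩ := D.exists_flow_or_cut m hm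
    (fun e => {z | IsTight (f e) (g e) (e ∈ L) (p (D.head e) - p (D.tail e)) z})
    (fun e => ⟨y e, hpy e⟩)
  · exact ⟨p, z, hflow, hz⟩
  exfalso
  have hyz : D.dualValue m g L p y = D.dualValue m g L p z := by
    simp only [dualValue]
    congr 1
    exact Finset.sum_congr rfl fun e _ =>
      le_antisymm ((hz e).2 _ (hpy e).1) ((hpy e).2 _ (hz e).1)
  -- Raising the potential by one on `Z` keeps the values `z` tight.
  let p' : V → ℤ := fun v => p v + if v ∈ Z then 1 else 0
  have hz' : ∀ e, IsTight (f e) (g e) (e ∈ L) (p' (D.head e) - p' (D.tail e)) (z e) := by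
    intro e
    by_cases h : D.head e ∈ Z <;> by_cases t : D.tail e ∈ Z
    · simpa [p', h, t] using hz e
    · have := (hz e).add_one (hent e ⟨h, t⟩)
      simpa [p', h, t, sub_add_eq_add_sub] using this
    · have := (hz e).sub_one (hlea e ⟨t, h⟩)
      simpa [p', h, t, sub_sub] using this
    · simpa [p', h, t] using hz e
  have hgain : D.dualValue m g L p' z =
      D.dualValue m g L p z + (∑ v ∈ Z, m v - (D.inSum z Z - D.outSum z Z)) := by
    have h1 : ∑ v, p' v * m v = ∑ v, p v * m v + ∑ v ∈ Z, m v := by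
      simp [p', add_mul, Finset.sum_add_distrib]
    have h2 : ∑ e, ((p' (D.head e) - p' (D.tail e)) * z e - satCost (e ∈ L) (g e) (z e)) =
        ∑ e, ((p (D.head e) - p (D.tail e)) * z e - satCost (e ∈ L) (g e) (z e)) +
          (D.inSum z Z - D.outSum z Z) := by
      rw [inSum_sub_outSum, ← Finset.sum_add_distrib]
      exact Finset.sum_congr rfl fun e _ => by simp only [p']; ring
    rw [dualValue, h1, h2, dualValue]
    ring
  have := hmax p' z hz'
  omega

end MultiDigraph

/-! ### Level sets of a potential -/

namespace MultiDigraph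

section LevelSets

variable {V A : Type*} [Fintype V] [DecidableEq V] (D : MultiDigraph V A)

/-- The chain of the upper level sets of a potential. -/
def levelChain (p : V → ℤ) : Finset (Finset V) :=
  Finset.univ.image fun u => Finset.univ.filter fun v => p u ≤ p v

theorem isChain_levelChain (p : V → ℤ) :
    IsChain (· ⊆ ·) (levelChain p : Set (Finset V)) := by
  intro Z hZ W hW _
  simp only [levelChain, Finset.coe_image, Finset.coe_univ, Set.image_univ, Set.mem_range] at hZ hW
  obtain ⟨u, rfl⟩ := hZ
  obtain ⟨w, rfl⟩ := hW
  rcases le_total (p u) (p w) with h | h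
  · right; intro v hv; simp only [Finset.mem_filter_univ] at hv ⊢; exact h.trans hv
  · left; intro v hv; simp only [Finset.mem_filter_univ] at hv ⊢; exact h.trans hv

theorem tension_pos_of_enters {p : V → ℤ} {e : A} {Z : Finset V} (hZ : Z ∈ levelChain p)
    (he : D.Enters e Z) : 0 < p (D.head e) - p (D.tail e) := by
  obtain ⟨u, -, rfl⟩ := Finset.mem_image.1 hZ
  simp only [Enters, Finset.mem_filter_univ] at he
  omega

theorem tension_neg_of_leaves {p : V → ℤ} {e : A} {Z : Finset V} (hZ : Z ∈ levelChain p)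
    (he : D.Leaves e Z) : p (D.head e) - p (D.tail e) < 0 := by
  obtain ⟨u, -, rfl⟩ := Finset.mem_image.1 hZ
  simp only [Leaves, Finset.mem_filter_univ] at he
  omega

theorem exists_enters_levelChain {p : V → ℤ} {e : A} (h : 0 < p (D.head e) - p (D.tail e)) :
    ∃ Z ∈ levelChain p, D.Enters e Z := by
  refine ⟨_, Finset.mem_image_of_mem _ (Finset.mem_univ (D.head e)), ?_⟩
  simp only [Enters, Finset.mem_filter_univ]
  omega

/-- An edge of tension one enters only one level set. -/
theorem levelChain_enters_unique {p : V → ℤ} {e : A} (h : p (D.head e) - p (D.tail e) = 1)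
    {Z W : Finset V} (hZ : Z ∈ levelChain p) (hW : W ∈ levelChain p)
    (heZ : D.Enters e Z) (heW : D.Enters e W) : Z = W := by
  obtain ⟨u, -, rfl⟩ := Finset.mem_image.1 hZ
  obtain ⟨w, -, rfl⟩ := Finset.mem_image.1 hW
  simp only [Enters, Finset.mem_filter_univ] at heZ heW
  rw [show p u = p w by omega]

end LevelSets

end MultiDigraph

/-! ### Chains and their values -/

section ERealSums

variable {ι : Type*} (s : Finset ι)

theorem EReal.coe_intCast_sum (w : ι → ℤ) :
    (((∑ i ∈ s, w i : ℤ) : ℝ) : EReal) = ∑ i ∈ s, ((w i : ℝ) : EReal) := by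
  rw [Int.cast_sum]
  exact map_sum (⟨⟨Real.toEReal, EReal.coe_zero⟩, EReal.coe_add⟩ : ℝ →+ EReal) _ s

theorem EReal.sum_ne_bot {w : ι → EReal} (h : ∀ i ∈ s, w i ≠ ⊥) : ∑ i ∈ s, w i ≠ ⊥ :=
  Finset.sum_induction w (· ≠ ⊥) (fun _ _ ha hb => EReal.add_ne_bot_iff.2 ⟨ha, hb⟩)
    EReal.zero_ne_bot h

theorem EReal.sum_ne_top {w : ι → EReal} (h : ∀ i ∈ s, w i ≠ ⊤) : ∑ i ∈ s, w i ≠ ⊤ :=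
  Finset.sum_induction w (· ≠ ⊤) (fun _ _ ha hb => EReal.add_ne_top ha hb) EReal.zero_ne_top h

theorem EReal.sum_eq_top {w : ι → EReal} (h : ∀ i ∈ s, w i ≠ ⊥) {j : ι} (hj : j ∈ s)
    (hw : w j = ⊤) : ∑ i ∈ s, w i = ⊤ := by
  classical
  rw [← Finset.add_sum_erase s w hj, hw]
  exact EReal.top_add_of_ne_bot (EReal.sum_ne_bot _ fun i hi => h i (Finset.mem_of_mem_erase hi))

theorem EReal.sum_eq_bot {w : ι → EReal} {j : ι} (hj : j ∈ s) (hw : w j = ⊥) :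
    ∑ i ∈ s, w i = ⊥ := by
  classical
  rw [← Finset.add_sum_erase s w hj, hw, EReal.bot_add]

end ERealSums

theorem upperToEReal_ne_bot (b : WithTop ℤ) : upperToEReal b ≠ ⊥ := by
  cases b with
  | top => exact top_ne_bot
  | coe b => exact EReal.coe_ne_bot _

theorem lowerToEReal_ne_top (a : WithBot ℤ) : lowerToEReal a ≠ ⊤ := by
  cases a with
  | bot => exact bot_ne_top
  | coe a => exact EReal.coe_ne_top _

namespace MultiDigraph

variable {V A : Type*} [Fintype A] [DecidableEq V] (D : MultiDigraph V A)
  {f : A → WithBot ℤ} {g : A → WithTop ℤ}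

theorem cutBound_eq_coe {Z : Finset V} (hg : ∀ e, D.Enters e Z → g e ≠ ⊤)
    (hf : ∀ e, D.Leaves e Z → f e ≠ ⊥) :
    D.cutBound f g Z =
      (((D.inSum (fun e => (g e).untopD 0) Z - D.outSum (fun e => (f e).unbotD 0) Z : ℤ) : ℝ) :
        EReal) := by
  rw [cutBound, Int.cast_sub, EReal.coe_sub]
  simp only [inSum, outSum, EReal.coe_intCast_sum]
  congr 1
  · refine Finset.sum_congr rfl fun e he => ?_
    obtain ⟨z, hz⟩ := WithTop.ne_top_iff_exists.1 (hg e (Finset.mem_filter.1 he).2)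
    rw [← hz, upperToEReal_coe, WithTop.untopD_coe]
  · refine Finset.sum_congr rfl fun e he => ?_
    obtain ⟨z, hz⟩ := WithBot.ne_bot_iff_exists.1 (hf e (Finset.mem_filter.1 he).2)
    rw [← hz, lowerToEReal_coe, WithBot.unbotD_coe]

theorem cutBound_lt_top_iff {Z : Finset V} :
    D.cutBound f g Z < ⊤ ↔ (∀ e, D.Enters e Z → g e ≠ ⊤) ∧ ∀ e, D.Leaves e Z → f e ≠ ⊥ := by
  refine ⟨fun h => ⟨fun e he hge => h.ne ?_, fun e he hfe => h.ne ?_⟩, fun h => ?_⟩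
  · rw [cutBound, inSum, EReal.sum_eq_top _ (fun e _ => upperToEReal_ne_bot _)
      (Finset.mem_filter.2 ⟨Finset.mem_univ e, he⟩) (by rw [hge, upperToEReal_top])]
    exact EReal.top_sub (EReal.sum_ne_top _ fun e _ => lowerToEReal_ne_top _)
  · rw [cutBound, outSum, EReal.sum_eq_bot _
      (Finset.mem_filter.2 ⟨Finset.mem_univ e, he⟩) (by rw [hfe, lowerToEReal_bot])]
    exact EReal.sub_bot (EReal.sum_ne_bot _ fun e _ => upperToEReal_ne_bot _)
  · rw [D.cutBound_eq_coe h.1 h.2]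
    exact EReal.coe_lt_top _

/-- The total distance of `x` from the upper bounds on the edges entering `Z` and from the lower
bounds on the edges leaving `Z`. Infinite bounds are read as zero. -/
noncomputable def slack (f : A → WithBot ℤ) (g : A → WithTop ℤ) (x : A → ℤ) (Z : Finset V) : ℤ :=
  D.inSum (fun e => (g e).untopD 0 - x e) Z + D.outSum (fun e => x e - (f e).unbotD 0) Z

theorem cutBound_sub_eq_slack {m : V → ℤ} {x : A → ℤ} (hx : ∀ v, D.netIn x v = m v)
    {Z : Finset V} (hZ : D.cutBound f g Z < ⊤) :
    D.cutBound f g Z - (((∑ v ∈ Z, m v : ℤ) : ℝ) : EReal) = ((D.slack f g x Z : ℝ) : EReal) := by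
  obtain ⟨h1, h2⟩ := D.cutBound_lt_top_iff.1 hZ
  rw [D.cutBound_eq_coe h1 h2, ← EReal.coe_sub, ← Int.cast_sub]
  congr 2
  simp only [← hx, sum_netIn, slack, inSum, outSum, Finset.sum_sub_distrib]
  ring

/-- Every integral flow turns the value of a chain into an integer. -/
theorem chainValue_eq_coe {m : V → ℤ} {x : A → ℤ} (hx : ∀ v, D.netIn x v = m v)
    (L : Finset A) {C : Finset (Finset V)} (hC : D.IsFiniteChain f g C) :
    D.chainValue f g m L C =
      (((D.enteringCount L C - ∑ Z ∈ C, D.slack f g x Z : ℤ) : ℝ) : EReal) := by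
  rw [chainValue, Finset.sum_congr rfl fun Z hZ => D.cutBound_sub_eq_slack hx (hC.2 Z hZ),
    ← EReal.coe_intCast_sum, Int.cast_sub, EReal.coe_sub, Int.cast_natCast, EReal.coe_natCast]

/-- Weak duality: an edge of `L` that enters a member of the chain and is not saturated adds at
least one to the slack of that member. -/
theorem chainValue_le_saturatedCount {m : V → ℤ} {x : A → ℤ}
    (hx : D.IsIntFeasibleModFlow f g m x) {L : Finset A} {C : Finset (Finset V)}
    (hC : D.IsFiniteChain f g C) :
    D.chainValue f g m L C ≤ (saturatedCount g L x : EReal) := by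
  classical
  obtain ⟨hx1, hx2⟩ := D.isIntFeasibleModFlow_iff.1 hx
  rw [D.chainValue_eq_coe hx1 L hC, ← EReal.coe_natCast, EReal.coe_le_coe_iff]
  suffices h : (D.enteringCount L C : ℤ) ≤ saturatedCount g L x + ∑ Z ∈ C, D.slack f g x Z by
    have : (D.enteringCount L C - ∑ Z ∈ C, D.slack f g x Z : ℤ) ≤ saturatedCount g L x := by
      linarith
    exact_mod_cast this
  have h1 : ∀ Z ∈ C, (({e ∈ L | D.Enters e Z ∧ (x e : WithTop ℤ) ≠ g e}.card : ℕ) : ℤ) ≤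
      D.slack f g x Z := by
    intro Z hZ
    obtain ⟨hg, hf⟩ := D.cutBound_lt_top_iff.1 (hC.2 Z hZ)
    have hin : ∀ e, D.Enters e Z → 0 ≤ (g e).untopD 0 - x e ∧
        ((x e : WithTop ℤ) ≠ g e → 1 ≤ (g e).untopD 0 - x e) := by
      intro e he
      obtain ⟨z, hz⟩ := WithTop.ne_top_iff_exists.1 (hg e he)
      have hle := (hx2 e).2
      rw [← hz, WithTop.coe_le_coe] at hle
      rw [← hz, WithTop.untopD_coe]
      refine ⟨by omega, fun hne => ?_⟩
      have : x e ≠ z := fun h => hne (by rw [h])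
      omega
    have hout : 0 ≤ D.outSum (fun e => x e - (f e).unbotD 0) Z := by
      refine Finset.sum_nonneg fun e he => ?_
      obtain ⟨z, hz⟩ := WithBot.ne_bot_iff_exists.1 (hf e (Finset.mem_filter.1 he).2)
      have hle := (hx2 e).1
      rw [← hz, WithBot.coe_le_coe] at hle
      rw [← hz, WithBot.unbotD_coe]
      omega
    refine le_trans ?_ (le_add_of_nonneg_right hout)
    rw [Finset.cast_card]
    refine le_trans (Finset.sum_le_sum (g := fun e => (g e).untopD 0 - x e) fun e he => ?_)
      (Finset.sum_le_sum_of_subset_of_nonneg (fun e he => ?_) fun e he _ => ?_)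
    · obtain ⟨-, h2, h3⟩ := Finset.mem_filter.1 he
      exact (hin e h2).2 h3
    · exact Finset.mem_filter.2 ⟨Finset.mem_univ e, (Finset.mem_filter.1 he).2.1⟩
    · exact (hin e (Finset.mem_filter.1 he).2).1
  have h2 : D.enteringCount L C ≤ saturatedCount g L x +
      ∑ Z ∈ C, {e ∈ L | D.Enters e Z ∧ (x e : WithTop ℤ) ≠ g e}.card := by
    refine le_trans ?_ ((Finset.card_union_le _ _).trans
      (Nat.add_le_add_left Finset.card_biUnion_le _))
    refine Finset.card_le_card fun e he => ?_
    obtain ⟨heL, Z, hZ, hent⟩ := Finset.mem_filter.1 he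
    by_cases h : (x e : WithTop ℤ) = g e
    · exact Finset.mem_union_left _ (Finset.mem_filter.2 ⟨heL, h⟩)
    · exact Finset.mem_union_right _ (Finset.mem_biUnion.2
        ⟨Z, hZ, Finset.mem_filter.2 ⟨heL, hent, h⟩⟩)
  have h3 := Finset.sum_le_sum h1
  have h4 : (D.enteringCount L C : ℤ) ≤ saturatedCount g L x +
      ∑ Z ∈ C, (({e ∈ L | D.Enters e Z ∧ (x e : WithTop ℤ) ≠ g e}.card : ℕ) : ℤ) := by
    exact_mod_cast h2
  linarith

section Attainment

variable [Fintype V] {L : Finset A} {p : V → ℤ} {y : A → ℤ}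

theorem isFiniteChain_levelChain (hL : ∀ e ∈ L, g e < ⊤)
    (h : ∀ e, IsTight (f e) (g e) (e ∈ L) (p (D.head e) - p (D.tail e)) (y e)) :
    D.IsFiniteChain f g (levelChain p) := by
  refine ⟨isChain_levelChain p, fun Z hZ => D.cutBound_lt_top_iff.2
    ⟨fun e he => ?_, fun e he => ?_⟩⟩
  · rcases (h e).of_pos (D.tension_pos_of_enters hZ he) (hL e) with h1 | ⟨-, -, h1⟩ <;>
      exact h1 ▸ WithTop.coe_ne_top
  · exact (h e).of_neg (D.tension_neg_of_leaves hZ he) ▸ WithBot.coe_ne_bot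

/-- Complementary slackness makes weak duality an equation: the slack of a level set counts the
edges of `L` that enter it one unit below their upper bound, these edges enter no other level
set, and every saturated edge of `L` enters some level set. -/
theorem saturatedCount_le_chainValue {m : V → ℤ} (hy : ∀ v, D.netIn y v = m v)
    (hL : ∀ e ∈ L, lowerToEReal (f e) < upperToEReal (g e) ∧ g e < ⊤)
    (h : ∀ e, IsTight (f e) (g e) (e ∈ L) (p (D.head e) - p (D.tail e)) (y e)) :
    (saturatedCount g L y : EReal) ≤ D.chainValue f g m L (levelChain p) := by
  classical
  rw [D.chainValue_eq_coe hy L (D.isFiniteChain_levelChain (fun e he => (hL e he).2) h),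
    ← EReal.coe_natCast, EReal.coe_le_coe_iff]
  suffices hs : saturatedCount g L y + ∑ Z ∈ levelChain p, D.slack f g y Z ≤
      (D.enteringCount L (levelChain p) : ℤ) by
    have : (saturatedCount g L y : ℤ) ≤
        (D.enteringCount L (levelChain p) - ∑ Z ∈ levelChain p, D.slack f g y Z : ℤ) := by
      linarith
    exact_mod_cast this
  let T : Finset V → Finset A := fun Z => {e ∈ L | D.Enters e Z ∧ (y e : WithTop ℤ) ≠ g e}
  have hT : ∀ Z ∈ levelChain p, ∀ e ∈ T Z, p (D.head e) - p (D.tail e) = 1 := by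
    intro Z hZ e he
    obtain ⟨-, h2, h3⟩ := Finset.mem_filter.1 he
    exact (((h e).of_pos (D.tension_pos_of_enters hZ h2) fun he => (hL e he).2).resolve_left h3).2.1
  have hslack : ∀ Z ∈ levelChain p, D.slack f g y Z = (T Z).card := by
    intro Z hZ
    have hout : D.outSum (fun e => y e - (f e).unbotD 0) Z = 0 := by
      refine Finset.sum_eq_zero fun e he => ?_
      rw [(h e).of_neg (D.tension_neg_of_leaves hZ (Finset.mem_filter.1 he).2),
        WithBot.unbotD_coe, sub_self]
    rw [slack, hout, add_zero, inSum, Finset.cast_card]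
    symm
    refine Finset.sum_subset_zero_on_sdiff (fun e he => ?_) (fun e he => ?_) fun e he => ?_
    · exact Finset.mem_filter.2 ⟨Finset.mem_univ e, (Finset.mem_filter.1 he).2.1⟩
    · obtain ⟨he1, he2⟩ := Finset.mem_sdiff.1 he
      have hent := (Finset.mem_filter.1 he1).2
      have hsat : (y e : WithTop ℤ) = g e := by
        rcases (h e).of_pos (D.tension_pos_of_enters hZ hent) (fun he => (hL e he).2) with
          h1 | ⟨h1, -⟩
        · exact h1
        · by_contra hne
          exact he2 (Finset.mem_filter.2 ⟨h1, hent, hne⟩)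
      rw [← hsat, WithTop.untopD_coe, sub_self]
    · obtain ⟨-, h2, h3⟩ := Finset.mem_filter.1 he
      obtain ⟨-, -, h4⟩ := ((h e).of_pos (D.tension_pos_of_enters hZ h2)
        fun he => (hL e he).2).resolve_left h3
      rw [← h4, WithTop.untopD_coe]
      ring
  rw [Finset.sum_congr rfl hslack, ← Nat.cast_sum, ← Nat.cast_add, Nat.cast_le,
    ← Finset.card_biUnion fun Z hZ W hW hne => Finset.disjoint_left.2 fun e heZ heW => hne
      (D.levelChain_enters_unique (hT Z hZ e heZ) hZ hW
        (Finset.mem_filter.1 heZ).2.1 (Finset.mem_filter.1 heW).2.1),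
    saturatedCount, ← Finset.card_union_of_disjoint]
  · refine Finset.card_le_card (Finset.union_subset (fun e he => ?_) fun e he => ?_)
    · obtain ⟨heL, hsat⟩ := Finset.mem_filter.1 he
      refine Finset.mem_filter.2 ⟨heL, D.exists_enters_levelChain
        ((h e).pos_of_saturated heL hsat ?_)⟩
      have hlt := (hL e heL).1
      rw [← hsat] at hlt
      refine lt_of_le_of_ne (h e).1.1 fun heq => ?_
      rw [heq] at hlt
      exact lt_irrefl _ hlt
    · obtain ⟨Z, hZ, heZ⟩ := Finset.mem_biUnion.1 he
      obtain ⟨heL, hent, -⟩ := Finset.mem_filter.1 heZ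
      exact Finset.mem_filter.2 ⟨heL, Z, hZ, hent⟩
  · refine Finset.disjoint_left.2 fun e he he' => ?_
    obtain ⟨Z, -, heZ⟩ := Finset.mem_biUnion.1 he'
    exact (Finset.mem_filter.1 heZ).2.2 (Finset.mem_filter.1 he).2

end Attainment

end MultiDigraph

theorem mainTheorem5 {V A : Type*} [Fintype V] [DecidableEq V] [Fintype A]
    (D : MultiDigraph V A) (m : V → ℤ) (hm : ∑ v, m v = 0)
    (f : A → WithBot ℤ) (g : A → WithTop ℤ)
    (hfg : ∀ e, lowerToEReal (f e) ≤ upperToEReal (g e))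
    (L : Finset A)
    (hL : ∀ e ∈ L, ⊥ < f e ∧ lowerToEReal (f e) < upperToEReal (g e) ∧ g e < ⊤)
    (hQ : ∃ x : A → ℝ, D.IsFeasibleModFlow f g m x) :
    ∃ k : ℕ,
      IsLeast {n : ℕ | ∃ x : A → ℤ, D.IsIntFeasibleModFlow f g m x ∧ n = saturatedCount g L x} k ∧
      IsGreatest {v : EReal | ∃ C : Finset (Finset V),
        D.IsFiniteChain f g C ∧ v = D.chainValue f g m L C} (k : EReal) ∧
      (k = 0 → IsGreatest {v : EReal | ∃ C : Finset (Finset V),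
        D.IsFiniteChain f g C ∧ v = D.chainValue f g m L C} (D.chainValue f g m L ∅)) := by
  obtain ⟨p, y, hy, ht⟩ := D.exists_flow_isTight hm hL hQ
  have hfeas : D.IsIntFeasibleModFlow f g m y :=
    D.isIntFeasibleModFlow_iff.2 ⟨hy, fun e => (ht e).1⟩
  have hfin := D.isFiniteChain_levelChain (fun e he => (hL e he).2.2) ht
  have hval : (saturatedCount g L y : EReal) = D.chainValue f g m L (MultiDigraph.levelChain p) :=
    le_antisymm (D.saturatedCount_le_chainValue hy (fun e he => (hL e he).2) ht)
      (D.chainValue_le_saturatedCount hfeas hfin)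
  have hmax : IsGreatest {v : EReal | ∃ C : Finset (Finset V),
      D.IsFiniteChain f g C ∧ v = D.chainValue f g m L C} (saturatedCount g L y : EReal) := by
    refine ⟨⟨_, hfin, hval⟩, ?_⟩
    rintro v ⟨C, hC, rfl⟩
    exact D.chainValue_le_saturatedCount hfeas hC
  refine ⟨saturatedCount g L y, ⟨⟨y, hfeas, rfl⟩, ?_⟩, hmax, fun hk => ?_⟩
  · rintro n ⟨x, hx, rfl⟩
    exact EReal.natCast_le_iff.1 (hval.trans_le (D.chainValue_le_saturatedCount hx hfin))
  · have hempty : D.chainValue f g m L ∅ = (saturatedCount g L y : EReal) := by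
      simp [hk, MultiDigraph.chainValue, MultiDigraph.enteringCount]
    rwa [hempty]
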